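/- Let $(M^n,g)$ be a smooth Riemannian manifold (without boundary, not necessarily complete) with Levi-Civita connection $\nabla$. A Codazzi tensor on $M$ is a smooth symmetric $(0,2)$-tensor field $T$ with $(\nabla_X T)(Y,Z)=(\nabla_Y T)(X,Z)$ for all vector fields $X,Y,Z$. A Codazzi tensor is called isoparametric if its eigenvalues with respect to $g$ are constant, i.e. are the same at every point of $M$. Theorem. Let $T$ be an isoparametric tensor on $(M^n,g)$. If all sectional curvatures of $(M^n,g)$ are non-negative, or all sectional curvatures of $(M^n,g)$ are non-positive, then $T$ is parallel, i.e. $\nabla T=0$. -/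

import Mathlib

open Bundle VectorField
open scoped Manifold ContDiff

noncomputable section

namespace Riem

section LeviCivita

/-! ### The Levi-Civita connection of a Riemannian metric -/

variable {E : Type*} [NormedAddCommGroup E] [NormedSpace ℝ E]
  {H : Type*} [TopologicalSpace H] {I : ModelWithCorners ℝ E H}
  {M : Type*} [TopologicalSpace M] [ChartedSpace H M]
  [RiemannianBundle (fun x : M ↦ TangentSpace I x)]

/-- The right-hand side of the Koszul formula for `2 ⟨∇_X Y, Z⟩` at the point `x`:
`X⟨Y, Z⟩ + Y⟨X, Z⟩ - Z⟨X, Y⟩ + ⟨[X, Y], Z⟩ - ⟨[X, Z], Y⟩ - ⟨[Y, Z], X⟩`. -/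
def koszul (X Y Z : Π x : M, TangentSpace I x) (x : M) : ℝ :=
  d% (fun y ↦ inner ℝ (Y y) (Z y)) x (X x)
    + d% (fun y ↦ inner ℝ (X y) (Z y)) x (Y x)
    - d% (fun y ↦ inner ℝ (X y) (Y y)) x (Z x)
    + inner ℝ (mlieBracket I X Y x) (Z x)
    - inner ℝ (mlieBracket I X Z x) (Y x)
    - inner ℝ (mlieBracket I Y Z x) (X x)

variable [IsManifold I ∞ M]
  [IsContMDiffRiemannianBundle I ∞ E (fun x : M ↦ TangentSpace I x)]

lemma mdiffAt_inner {x : M} {X Y : Π x : M, TangentSpace I x}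
    (hX : MDiffAt (T% X) x) (hY : MDiffAt (T% Y) x) :
    MDiffAt (fun y ↦ inner ℝ (X y) (Y y)) x :=
  MDifferentiableAt.inner_bundle (E := fun x : M ↦ TangentSpace I x) hX hY

variable [FiniteDimensional ℝ E]

lemma koszul_tensorial_left {x : M} {Y Z : Π x : M, TangentSpace I x}
    (hY : MDiffAt (T% Y) x) (hZ : MDiffAt (T% Z) x) :
    TensorialAt I E (fun X : Π x : M, TangentSpace I x ↦ koszul X Y Z x) x where
  smul {f X} hf hX := by
    have : CompleteSpace E := FiniteDimensional.complete ℝ E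
    have h1 := mvfderiv_fun_mul hf (mdiffAt_inner hX hZ)
    have h2 := mvfderiv_fun_mul hf (mdiffAt_inner hX hY)
    simp only [koszul, Pi.smul_apply', real_inner_smul_left, real_inner_smul_right, h1, h2,
      mlieBracket_smul_left hf hX, inner_add_left, map_smul, smul_eq_mul,
      add_apply, smul_apply]
    rw [real_inner_comm (Z x) (X x)]
    ring
  add {X X'} hX hX' := by
    have : CompleteSpace E := FiniteDimensional.complete ℝ E
    have h1 := mvfderiv_fun_add (mdiffAt_inner hX hZ) (mdiffAt_inner hX' hZ)
    have h2 := mvfderiv_fun_add (mdiffAt_inner hX hY) (mdiffAt_inner hX' hY)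
    simp only [koszul, Pi.add_apply, inner_add_left, inner_add_right, h1, h2,
      mlieBracket_add_left hX hX', map_add, add_apply]
    ring

lemma koszul_tensorial_right {x : M} {X Y : Π x : M, TangentSpace I x}
    (hX : MDiffAt (T% X) x) (hY : MDiffAt (T% Y) x) :
    TensorialAt I E (fun Z : Π x : M, TangentSpace I x ↦ koszul X Y Z x) x where
  smul {f Z} hf hZ := by
    have : CompleteSpace E := FiniteDimensional.complete ℝ E
    have h1 := mvfderiv_fun_mul hf (mdiffAt_inner hY hZ)
    have h2 := mvfderiv_fun_mul hf (mdiffAt_inner hX hZ)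
    simp only [koszul, Pi.smul_apply', real_inner_smul_left, real_inner_smul_right, h1, h2,
      mlieBracket_smul_right hf hZ, inner_add_left, map_smul, smul_eq_mul,
      add_apply, smul_apply]
    rw [real_inner_comm (Z x) (X x), real_inner_comm (Z x) (Y x)]
    ring
  add {Z Z'} hZ hZ' := by
    have : CompleteSpace E := FiniteDimensional.complete ℝ E
    have h1 := mvfderiv_fun_add (mdiffAt_inner hY hZ) (mdiffAt_inner hY hZ')
    have h2 := mvfderiv_fun_add (mdiffAt_inner hX hZ) (mdiffAt_inner hX hZ')
    simp only [koszul, Pi.add_apply, inner_add_left, inner_add_right, h1, h2,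
      mlieBracket_add_right hZ hZ', map_add, add_apply]
    ring

open Classical in
/-- The Levi-Civita connection as a bare function: `leviCivitaFun Y x v` is the vector `∇_v Y`
determined by the Koszul formula. As for all of Mathlib's covariant derivatives, its value is
only meaningful if `Y` is differentiable at `x`. -/
def leviCivitaFun (Y : Π x : M, TangentSpace I x) (x : M) :
    TangentSpace I x →L[ℝ] TangentSpace I x :=
  if hY : MDiffAt (T% Y) x then
    letI B : TangentSpace I x →L[ℝ] TangentSpace I x →L[ℝ] ℝ :=
      TensorialAt.mkHom₂ (fun X Z ↦ koszul X Y Z x) x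
        (fun _ hZ ↦ koszul_tensorial_left hY hZ) (fun _ hX ↦ koszul_tensorial_right hX hY)
    haveI : FiniteDimensional ℝ (TangentSpace I x) := inferInstanceAs (FiniteDimensional ℝ E)
    haveI : CompleteSpace (TangentSpace I x) := FiniteDimensional.complete ℝ _
    LinearMap.toContinuousLinearMap
      { toFun := fun v ↦ (1 / 2 : ℝ) • (InnerProductSpace.toDual ℝ (TangentSpace I x)).symm (B v)
        map_add' := fun v w ↦ by rw [map_add, map_add, smul_add]
        map_smul' := fun c v ↦ by
          rw [map_smul, map_smulₛₗ, smul_comm]; rfl }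
  else 0

lemma inner_leviCivitaFun {x : M} {X Y Z : Π x : M, TangentSpace I x}
    (hX : MDiffAt (T% X) x) (hY : MDiffAt (T% Y) x) (hZ : MDiffAt (T% Z) x) :
    inner ℝ (leviCivitaFun Y x (X x)) (Z x) = 1 / 2 * koszul X Y Z x := by
  have : FiniteDimensional ℝ (TangentSpace I x) := inferInstanceAs (FiniteDimensional ℝ E)
  have : CompleteSpace (TangentSpace I x) := FiniteDimensional.complete ℝ _
  rw [leviCivitaFun, dif_pos hY]
  have h := TensorialAt.mkHom₂_apply (Φ := fun X Z ↦ koszul X Y Z x)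
    (fun _ hZ ↦ koszul_tensorial_left hY hZ) (fun _ hX ↦ koszul_tensorial_right hX hY) hX hZ
  rw [← h]
  simp only [LinearMap.coe_toContinuousLinearMap', LinearMap.coe_mk, AddHom.coe_mk,
    real_inner_smul_left]
  congr 1
  exact InnerProductSpace.toDual_symm_apply

lemma ext_inner_extend {x : M} {v w : TangentSpace I x}
    (h : ∀ Z : Π x : M, TangentSpace I x, MDiffAt (T% Z) x →
      inner ℝ v (Z x) = inner ℝ w (Z x)) : v = w := by
  refine ext_inner_right ℝ fun z ↦ ?_
  simpa using h (FiberBundle.extend E z) (FiberBundle.mdifferentiableAt_extend ..)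

lemma isCovariantDerivativeOn_leviCivitaFun :
    IsCovariantDerivativeOn (M := M) (I := I) E leviCivitaFun Set.univ where
  add {Y Y' x} hY hY' _ := by
    have : CompleteSpace E := FiniteDimensional.complete ℝ E
    ext v
    refine ext_inner_extend fun Z hZ ↦ ?_
    have hX : MDiffAt (T% (FiberBundle.extend E v)) x := FiberBundle.mdifferentiableAt_extend ..
    have h1 := mvfderiv_fun_add (mdiffAt_inner hY hZ) (mdiffAt_inner hY' hZ)
    have h2 := mvfderiv_fun_add (mdiffAt_inner hX hY) (mdiffAt_inner hX hY')
    have e1 := inner_leviCivitaFun hX hY hZ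
    have e2 := inner_leviCivitaFun hX hY' hZ
    have e3 := inner_leviCivitaFun hX (mdifferentiableAt_add_section hY hY') hZ
    simp only [koszul, Pi.add_apply, inner_add_left, inner_add_right, h1, h2,
      mlieBracket_add_left hY hY', mlieBracket_add_right hY hY', map_add, add_apply,
      FiberBundle.extend_apply_self] at e1 e2 e3 ⊢
    linarith
  leibniz {Y f x} hY hf _ := by
    have : CompleteSpace E := FiniteDimensional.complete ℝ E
    ext v
    refine ext_inner_extend fun Z hZ ↦ ?_
    have hX : MDiffAt (T% (FiberBundle.extend E v)) x := FiberBundle.mdifferentiableAt_extend ..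
    have h1 := mvfderiv_fun_mul hf (mdiffAt_inner hY hZ)
    have h2 := mvfderiv_fun_mul hf (mdiffAt_inner hX hY)
    have e1 := inner_leviCivitaFun hX hY hZ
    have e3 := inner_leviCivitaFun hX (hf.smul_section hY) hZ
    simp only [koszul, Pi.smul_apply', real_inner_smul_left, real_inner_smul_right, h1, h2,
      mlieBracket_smul_left hf hY, mlieBracket_smul_right hf hY, inner_add_left, map_smul,
      smul_eq_mul, add_apply, smul_apply, ContinuousLinearMap.smulRight_apply,
      FiberBundle.extend_apply_self] at e1 e3 ⊢
    rw [e3, e1, real_inner_comm v (Y x)]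
    ring

variable (I M) in
/-- The Levi-Civita connection (the Riemannian connection) of a Riemannian manifold:
`leviCivita I M Y x v` is `∇_v Y` at `x`. -/
def leviCivita : CovariantDerivative I E (fun x : M ↦ TangentSpace I x) :=
  ⟨leviCivitaFun, isCovariantDerivativeOn_leviCivitaFun⟩

/-- The Levi-Civita connection is compatible with the metric. -/
lemma leviCivita_isMetricCompatible :
    CovariantDerivative.IsMetricCompatible (V := fun x : M ↦ TangentSpace I x)
      (leviCivita I M) := by
  have : CompleteSpace E := FiniteDimensional.complete ℝ E
  rw [CovariantDerivative.isMetricCompatible_iff]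
  intro x X σ τ hX hσ hτ
  have e1 := inner_leviCivitaFun hX hσ hτ
  have e2 := inner_leviCivitaFun hX hτ hσ
  have s1 : (fun y ↦ inner ℝ (τ y) (σ y)) = (fun y ↦ inner ℝ (σ y) (τ y)) :=
    funext fun y ↦ real_inner_comm _ _
  simp only [koszul, s1] at e1 e2
  rw [mlieBracket_swap_apply (V := τ) (W := σ), inner_neg_left] at e2
  simp only [leviCivita]
  rw [real_inner_comm _ (σ x), e1, e2]
  ring

/-- The Levi-Civita connection is torsion-free. -/
lemma leviCivita_torsion : (leviCivita I M).torsion = 0 := by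
  have : CompleteSpace E := FiniteDimensional.complete ℝ E
  rw [CovariantDerivative.torsion_eq_zero_iff]
  intro X Y x hX hY
  refine ext_inner_extend fun Z hZ ↦ ?_
  have e1 := inner_leviCivitaFun hX hY hZ
  have e2 := inner_leviCivitaFun hY hX hZ
  have s1 : (fun y ↦ inner ℝ (Y y) (X y)) = (fun y ↦ inner ℝ (X y) (Y y)) :=
    funext fun y ↦ real_inner_comm _ _
  simp only [koszul, s1] at e1 e2
  rw [mlieBracket_swap_apply (V := Y) (W := X), inner_neg_left] at e2
  simp only [leviCivita]
  rw [inner_sub_left, e1, e2]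
  ring

end LeviCivita

section Tensors

/-! ### Symmetric `(0,2)`-tensors and curvature -/

variable {E : Type*} [NormedAddCommGroup E] [NormedSpace ℝ E] [FiniteDimensional ℝ E]
  {H : Type*} [TopologicalSpace H] {I : ModelWithCorners ℝ E H}
  {M : Type*} [TopologicalSpace M] [ChartedSpace H M] [IsManifold I ∞ M]
  [RiemannianBundle (fun x : M ↦ TangentSpace I x)]
  [IsContMDiffRiemannianBundle I ∞ E (fun x : M ↦ TangentSpace I x)]

/-- The covariant derivative of a `(0,2)`-tensor field `T` evaluated at vector fields:
`(∇_X T)(Y, Z) = X (T(Y, Z)) - T(∇_X Y, Z) - T(Y, ∇_X Z)` at the point `x`. -/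
def covDerivTensor (T : Π x : M, TangentSpace I x →L[ℝ] TangentSpace I x →L[ℝ] ℝ)
    (X Y Z : Π x : M, TangentSpace I x) (x : M) : ℝ :=
  d% (fun y ↦ T y (Y y) (Z y)) x (X x)
    - T x (leviCivita I M Y x (X x)) (Z x) - T x (Y x) (leviCivita I M Z x (X x))

/-- A Codazzi tensor: a smooth symmetric `(0,2)`-tensor field `T` such that
`(∇_X T)(Y, Z) = (∇_Y T)(X, Z)` for all (local) smooth vector fields `X, Y, Z`. -/
structure IsCodazzi (T : Π x : M, TangentSpace I x →L[ℝ] TangentSpace I x →L[ℝ] ℝ) : Prop where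
  contMDiff : ContMDiff I (I.prod 𝓘(ℝ, E →L[ℝ] E →L[ℝ] ℝ)) ∞
    (fun x ↦ TotalSpace.mk' (E →L[ℝ] E →L[ℝ] ℝ)
      (E := fun x : M ↦ TangentSpace I x →L[ℝ] TangentSpace I x →L[ℝ] ℝ) x (T x))
  symm : ∀ (x : M) (v w : TangentSpace I x), T x v w = T x w v
  codazzi : ∀ (x : M) (X Y Z : Π x : M, TangentSpace I x),
    CMDiffAt ∞ (T% X) x → CMDiffAt ∞ (T% Y) x → CMDiffAt ∞ (T% Z) x →
      covDerivTensor T X Y Z x = covDerivTensor T Y X Z x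

/-- `μ` is an eigenvalue of the `(0,2)`-tensor `T` at `x` with respect to the metric: some nonzero
tangent vector `v` satisfies `T(v, w) = μ ⟨v, w⟩` for all `w`. -/
def IsEigenvalueAt (T : Π x : M, TangentSpace I x →L[ℝ] TangentSpace I x →L[ℝ] ℝ)
    (x : M) (μ : ℝ) : Prop :=
  ∃ v : TangentSpace I x, v ≠ 0 ∧ ∀ w : TangentSpace I x, T x v w = μ * inner ℝ v w

/-- An isoparametric tensor: a Codazzi tensor whose eigenvalues are constant, that is, the same
at all points. -/
structure IsIsoparametric (T : Π x : M, TangentSpace I x →L[ℝ] TangentSpace I x →L[ℝ] ℝ) : Prop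
    extends IsCodazzi T where
  eigenvalues_const : ∀ (x y : M) (μ : ℝ), IsEigenvalueAt T x μ ↔ IsEigenvalueAt T y μ

/-- A `(0,2)`-tensor field is parallel if `∇T = 0`. -/
def IsParallel (T : Π x : M, TangentSpace I x →L[ℝ] TangentSpace I x →L[ℝ] ℝ) : Prop :=
  ∀ (x : M) (X Y Z : Π x : M, TangentSpace I x),
    CMDiffAt ∞ (T% X) x → CMDiffAt ∞ (T% Y) x → CMDiffAt ∞ (T% Z) x →
      covDerivTensor T X Y Z x = 0

/-- The Riemann curvature tensor evaluated at vector fields: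
`R(X, Y) Z = ∇_X ∇_Y Z - ∇_Y ∇_X Z - ∇_{[X, Y]} Z` at the point `x`. -/
def curvature (X Y Z : Π x : M, TangentSpace I x) (x : M) : TangentSpace I x :=
  leviCivita I M (fun y ↦ leviCivita I M Z y (Y y)) x (X x)
    - leviCivita I M (fun y ↦ leviCivita I M Z y (X y)) x (Y x)
    - leviCivita I M Z x (mlieBracket I X Y x)

/-- The sectional curvature at `x` of the plane spanned by `X x` and `Y x`, where `X` and `Y` are
vector fields that are smooth near `x` and linearly independent at `x`:
`⟨R(X, Y) Y, X⟩ / (|X|² |Y|² - ⟨X, Y⟩²)`. -/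
def sectionalCurvature (X Y : Π x : M, TangentSpace I x) (x : M) : ℝ :=
  inner ℝ (curvature X Y Y x) (X x) /
    (inner ℝ (X x) (X x) * inner ℝ (Y x) (Y x) - inner ℝ (X x) (Y x) ^ 2)

variable (I M) in
/-- All sectional curvatures are non-negative. -/
def HasNonnegSectionalCurvature : Prop :=
  ∀ (x : M) (X Y : Π x : M, TangentSpace I x),
    CMDiffAt ∞ (T% X) x → CMDiffAt ∞ (T% Y) x → LinearIndependent ℝ ![X x, Y x] →
      0 ≤ sectionalCurvature X Y x

variable (I M) in
/-- All sectional curvatures are non-positive. -/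
def HasNonposSectionalCurvature : Prop :=
  ∀ (x : M) (X Y : Π x : M, TangentSpace I x),
    CMDiffAt ∞ (T% X) x → CMDiffAt ∞ (T% Y) x → LinearIndependent ℝ ![X x, Y x] →
      sectionalCurvature X Y x ≤ 0

end Tensors

end Riem

end

/-! Since the eigenvalues are constant, each eigenvector at `x` extends to a smooth field of
eigenvectors (`IsIsoparametric.exists_eigenfield`). For such fields `e i` with eigenvalues `l i`,
the component `F a b d = (∇_{e a} T)(e b, e d)` equals `(l b - l d) ⟨∇_{e a} e b, e d⟩`. The Codazzi
equation makes `F` totally symmetric, so `F` vanishes as soon as two of its three eigenvalues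
coincide.

If the fields are orthonormal at `x` and `l a ≠ l b`, then `K(e a, e b) = ∑ d, 2 (F a b d)² / ((l b
- l d) (l a - l d))` (`IsEigenfield.inner_curvature_eq_arrayCurvature`). A term is negative only if
`l d` lies strictly between `l a` and `l b`.

The rest is an extremal choice among triples of increasing eigenvalues with `F ≠ 0`. The widest
triple gives a plane of negative curvature (`array_eq_zero_of_nonneg`); a triple whose two lower
eigenvalues are closest gives one of positive curvature (`array_eq_zero_of_nonpos`). So a sign on
the curvature forces `F = 0`. -/

noncomputable section

namespace Riem

/-! ### Smoothness of determinants and inverse matrices -/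

section MatrixSmoothness

variable {E : Type*} [NormedAddCommGroup E] [NormedSpace ℝ E]
  {H : Type*} [TopologicalSpace H] {I : ModelWithCorners ℝ E H}
  {M : Type*} [TopologicalSpace M] [ChartedSpace H M]
  {ι : Type*} [Fintype ι] [DecidableEq ι]

lemma contMDiffAt_det {k : WithTop ℕ∞} {x : M} {A : M → Matrix ι ι ℝ}
    (hA : ∀ i j, CMDiffAt k (fun y ↦ A y i j) x) : CMDiffAt k (fun y ↦ (A y).det) x := by
  simp only [Matrix.det_apply']
  exact contMDiffAt_finsetSum fun σ _ ↦
    contMDiffAt_const.mul (contMDiffAt_finsetProd fun i _ ↦ hA (σ i) i)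

lemma contMDiffAt_matrix_inv {k : WithTop ℕ∞} {x : M} {A : M → Matrix ι ι ℝ}
    (hA : ∀ i j, CMDiffAt k (fun y ↦ A y i j) x) (hx : (A x).det ≠ 0) (i j : ι) :
    CMDiffAt k (fun y ↦ (A y)⁻¹ i j) x := by
  have e (y : M) : (A y)⁻¹ i j = (A y).det⁻¹ * ((A y).updateRow j (Pi.single i 1)).det := by
    rw [Matrix.inv_def, Matrix.smul_apply, Matrix.adjugate_apply, Ring.inverse_eq_inv',
      smul_eq_mul]
  simp only [e]
  refine ((contMDiffAt_det hA).inv₀ hx).mul (contMDiffAt_det fun a b ↦ ?_)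
  by_cases h : a = j
  · subst h
    simpa using contMDiffAt_const
  · simpa [h] using hA a b

end MatrixSmoothness

/-! ### Smoothness of vector fields and of the Levi-Civita derivative -/

section Smoothness

variable {E : Type*} [NormedAddCommGroup E] [NormedSpace ℝ E]
  {H : Type*} [TopologicalSpace H] {I : ModelWithCorners ℝ E H}
  {M : Type*} [TopologicalSpace M] [ChartedSpace H M]

/-- The derivative of a function along a vector field loses one order of smoothness. -/
lemma contMDiffAt_mvfderiv_apply [IsManifold I 1 M] {m k : WithTop ℕ∞} {x : M} {f : M → ℝ}
    {X : Π x : M, TangentSpace I x} (hf : CMDiffAt k f x) (hX : CMDiffAt m (T% X) x)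
    (hmk : m + 1 ≤ k) : CMDiffAt m (fun y ↦ d% f y (X y)) x := by
  have hϕ : CMDiffAt m (fun y ↦ ContinuousLinearMap.inCoordinates E (TangentSpace I (M := M)) ℝ
      (TangentSpace 𝓘(ℝ, ℝ) (M := ℝ)) x y (f x) (f y) (mfderiv% f y)) x :=
    hf.mfderiv_const hmk
  have h := ContMDiffAt.clm_apply_of_inCoordinates hϕ hX (hf.of_le (le_self_add.trans hmk))
  have h2 := (contMDiffAt_totalSpace.1 h).2
  simp at h2
  exact h2

lemma eventually_mdifferentiableAt
    [IsManifold I ∞ M] {x : M} {X : Π x : M, TangentSpace I x}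
    (hX : CMDiffAt 1 (T% X) x) : ∀ᶠ y in nhds x, MDiffAt (T% X) y :=
  ((contMDiffAt_iff_contMDiffAt_nhds (by simp)).1 hX).mono fun _ h ↦ h.mdifferentiableAt one_ne_zero

variable [IsManifold I ∞ M] [RiemannianBundle (fun x : M ↦ TangentSpace I x)]
  [IsContMDiffRiemannianBundle I ∞ E (fun x : M ↦ TangentSpace I x)]

lemma contMDiffAt_inner {k : WithTop ℕ∞} (hk : k ≤ ∞) {x : M} {X Y : Π x : M, TangentSpace I x}
    (hX : CMDiffAt k (T% X) x) (hY : CMDiffAt k (T% Y) x) :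
    CMDiffAt k (fun y ↦ inner ℝ (X y) (Y y)) x := by
  have : IsContMDiffRiemannianBundle I k E (fun x : M ↦ TangentSpace I x) :=
    IsContMDiffRiemannianBundle.of_le hk
  exact ContMDiffAt.inner_bundle (E := fun x : M ↦ TangentSpace I x) hX hY

variable [FiniteDimensional ℝ E]

/-- A vector field is smooth if its inner products with all smooth vector fields are. -/
lemma contMDiffAt_of_inner {k : WithTop ℕ∞} (hk : k ≤ ∞) {x : M} {W : Π x : M, TangentSpace I x}
    (h : ∀ Z : Π x : M, TangentSpace I x, CMDiffAt ∞ (T% Z) x →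
      CMDiffAt k (fun y ↦ inner ℝ (W y) (Z y)) x) : CMDiffAt k (T% W) x := by
  classical
  let e := trivializationAt E (TangentSpace I (M := M)) x
  have hx : x ∈ e.baseSet := FiberBundle.mem_baseSet_trivializationAt' x
  let b := Module.finBasis ℝ E
  let s := e.localFrame b
  have hs := e.isLocalFrameOn_localFrame_baseSet I ∞ b
  have hsx (i) : CMDiffAt ∞ (T% (s i)) x := hs.contMDiffAt e.open_baseSet hx i
  let G : M → Matrix _ _ ℝ := fun y ↦ Matrix.gram ℝ (fun i ↦ s i y)
  have hG (i j) : CMDiffAt k (fun y ↦ G y i j) x :=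
    contMDiffAt_inner hk ((hsx i).of_le hk) ((hsx j).of_le hk)
  have hdet (y : M) (hy : y ∈ e.baseSet) : (G y).det ≠ 0 :=
    Matrix.det_gram_ne_zero_iff_linearIndependent.2 (hs.linearIndependent hy)
  have hc (i) : CMDiffAt k (fun y ↦ ∑ j, (G y)⁻¹ i j * inner ℝ (W y) (s j y)) x :=
    contMDiffAt_finsetSum fun j _ ↦
      (contMDiffAt_matrix_inv hG (hdet x hx) i j).mul (h _ (hsx j))
  have almost : CMDiffAt k
      (T% (fun y ↦ ∑ i, (∑ j, (G y)⁻¹ i j * inner ℝ (W y) (s j y)) • s i y)) x :=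
    .sum_section fun i _ ↦ (hc i).smul_section ((hsx i).of_le hk)
  refine almost.congr_of_eventuallyEq ?_
  filter_upwards [e.open_baseSet.mem_nhds hx] with y hy
  have hW := hs.coeff_sum_eq W hy
  set a := fun i ↦ hs.coeff i y (W y)
  -- The Gram matrix sends the frame coefficients of `W` to its inner products with the frame;
  -- inverting it recovers the coefficients without orthonormalizing the frame.
  have hin : (fun j ↦ inner ℝ (W y) (s j y)) = (G y).mulVec a := by
    ext j
    conv_lhs => rw [hW]
    simp only [sum_inner, real_inner_smul_left, Matrix.mulVec, dotProduct]
    refine Finset.sum_congr rfl fun i _ ↦ ?_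
    change a i * inner ℝ (s i y) (s j y) = inner ℝ (s j y) (s i y) * a i
    rw [real_inner_comm, mul_comm]
  have ha : a = (G y)⁻¹.mulVec (fun j ↦ inner ℝ (W y) (s j y)) := by
    rw [hin, Matrix.mulVec_mulVec, Matrix.nonsing_inv_mul _ (isUnit_iff_ne_zero.2 (hdet y hy)),
      Matrix.one_mulVec]
  refine congrArg (TotalSpace.mk' E y) ?_
  refine hW.trans (Finset.sum_congr rfl fun i _ ↦ ?_)
  change a i • s i y = _
  rw [ha]
  rfl

lemma contMDiffAt_koszul {m : ℕ∞} {x : M} {X Y Z : Π x : M, TangentSpace I x}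
    (hX : CMDiffAt (m + 1 : ℕ∞) (T% X) x) (hY : CMDiffAt (m + 1 : ℕ∞) (T% Y) x)
    (hZ : CMDiffAt (m + 1 : ℕ∞) (T% Z) x) : CMDiffAt m (fun y ↦ koszul X Y Z y) x := by
  have : CompleteSpace E := FiniteDimensional.complete ℝ E
  have hm : (m : WithTop ℕ∞) + 1 ≤ ((m + 1 : ℕ∞) : WithTop ℕ∞) := by simp
  have hk : ((m + 1 : ℕ∞) : WithTop ℕ∞) ≤ ∞ := by exact_mod_cast le_top
  have hk' : (m : WithTop ℕ∞) ≤ ∞ := le_self_add.trans (hm.trans hk)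
  have hm' : minSmoothness ℝ ((m : WithTop ℕ∞) + 1) ≤ ((m + 1 : ℕ∞) : WithTop ℕ∞) := by simp
  have : IsManifold I ((m + 1 : ℕ∞) + 1) M :=
    IsManifold.of_le (n := ∞) (by exact_mod_cast le_top)
  have : IsManifold I (minSmoothness ℝ 2) M := by
    rw [minSmoothness_of_isRCLikeNormedField]; infer_instance
  have low {V : Π x : M, TangentSpace I x} (hV : CMDiffAt (m + 1 : ℕ∞) (T% V) x) :
      CMDiffAt m (T% V) x := hV.of_le (le_self_add.trans hm)
  have br {V W : Π x : M, TangentSpace I x} (hV : CMDiffAt (m + 1 : ℕ∞) (T% V) x)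
      (hW : CMDiffAt (m + 1 : ℕ∞) (T% W) x) : CMDiffAt m (T% (mlieBracket I V W)) x :=
    hV.mlieBracket_vectorField hW hm'
  unfold koszul
  exact (((((contMDiffAt_mvfderiv_apply (contMDiffAt_inner hk hY hZ) (low hX) hm).add
    (contMDiffAt_mvfderiv_apply (contMDiffAt_inner hk hX hZ) (low hY) hm)).sub
    (contMDiffAt_mvfderiv_apply (contMDiffAt_inner hk hX hY) (low hZ) hm)).add
    (contMDiffAt_inner hk' (br hX hY) (low hZ))).sub
    (contMDiffAt_inner hk' (br hX hZ) (low hY))).sub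
    (contMDiffAt_inner hk' (br hY hZ) (low hX))

/-- The Levi-Civita derivative of a smooth vector field along a smooth one is smooth. -/
lemma contMDiffAt_leviCivita {m : ℕ∞} {x : M} {X Y : Π x : M, TangentSpace I x}
    (hX : CMDiffAt (m + 1 : ℕ∞) (T% X) x) (hY : CMDiffAt (m + 1 : ℕ∞) (T% Y) x) :
    CMDiffAt m (T% (fun y ↦ leviCivita I M Y y (X y))) x := by
  have h1 : (1 : WithTop ℕ∞) ≤ ((m + 1 : ℕ∞) : WithTop ℕ∞) := by simp
  refine contMDiffAt_of_inner (by exact_mod_cast le_top) fun Z hZ ↦ ?_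
  have hZ' : CMDiffAt (m + 1 : ℕ∞) (T% Z) x := hZ.of_le (by exact_mod_cast le_top)
  have hK := ContMDiffAt.mul (contMDiffAt_const (c := (1 / 2 : ℝ))) (contMDiffAt_koszul hX hY hZ')
  refine hK.congr_of_eventuallyEq ?_
  -- The Koszul formula is available only where all three fields are differentiable, which holds
  -- near `x` because their order `m + 1` is at least one.
  filter_upwards [eventually_mdifferentiableAt (hX.of_le h1),
    eventually_mdifferentiableAt (hY.of_le h1),
    eventually_mdifferentiableAt (hZ'.of_le h1)] with y hXy hYy hZy
  exact inner_leviCivitaFun hXy hYy hZy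

end Smoothness

/-! ### Diagonalization of symmetric bilinear forms -/

section LinearAlgebra

variable {V : Type*} [NormedAddCommGroup V] [InnerProductSpace ℝ V] [FiniteDimensional ℝ V]

/-- The endomorphism representing a bilinear form with respect to the inner product. -/
def formEndo (B : V →L[ℝ] V →L[ℝ] ℝ) : Module.End ℝ V :=
  haveI : CompleteSpace V := FiniteDimensional.complete ℝ V
  { toFun := fun v ↦ (InnerProductSpace.toDual ℝ V).symm (B v)
    map_add' := fun v w ↦ by rw [map_add, map_add]
    map_smul' := fun c v ↦ by rw [map_smul, map_smulₛₗ]; rfl }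

lemma inner_formEndo (B : V →L[ℝ] V →L[ℝ] ℝ) (v w : V) : inner ℝ (formEndo B v) w = B v w :=
  haveI : CompleteSpace V := FiniteDimensional.complete ℝ V
  InnerProductSpace.toDual_symm_apply

lemma formEndo_eq_smul_iff (B : V →L[ℝ] V →L[ℝ] ℝ) (v : V) (μ : ℝ) :
    formEndo B v = μ • v ↔ ∀ w, B v w = μ * inner ℝ v w := by
  refine ⟨fun h w ↦ ?_, fun h ↦ ext_inner_right ℝ fun w ↦ ?_⟩
  · rw [← inner_formEndo, h, real_inner_smul_left]
  · rw [inner_formEndo, h, real_inner_smul_left]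

/-- A symmetric bilinear form is diagonal in some orthonormal basis. -/
lemma exists_orthonormalBasis_eigenvectors (B : V →L[ℝ] V →L[ℝ] ℝ) (hB : ∀ v w, B v w = B w v) :
    ∃ (e : OrthonormalBasis (Fin (Module.finrank ℝ V)) ℝ V)
      (l : Fin (Module.finrank ℝ V) → ℝ), ∀ i w, B (e i) w = l i * inner ℝ (e i) w := by
  have hs : (formEndo B).IsSymmetric := fun v w ↦ by
    rw [inner_formEndo, real_inner_comm, inner_formEndo, hB]
  exact ⟨hs.eigenvectorBasis rfl, hs.eigenvalues rfl, fun i ↦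
    (formEndo_eq_smul_iff _ _ _).1 (hs.apply_eigenvectorBasis rfl i)⟩

omit [FiniteDimensional ℝ V] in
/-- The eigenvalues of a diagonal form are its diagonal entries. -/
lemma exists_eq_of_eigenvector {ι : Type*} [Fintype ι] {B : V →L[ℝ] V →L[ℝ] ℝ}
    (hB : ∀ v w, B v w = B w v) {e : OrthonormalBasis ι ℝ V} {l : ι → ℝ}
    (he : ∀ i w, B (e i) w = l i * inner ℝ (e i) w) {v : V} (hv : v ≠ 0) {μ : ℝ}
    (hμ : ∀ w, B v w = μ * inner ℝ v w) : ∃ i, l i = μ := by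
  by_contra! h
  refine hv (InnerProductSpace.ext_inner_left_basis e.toBasis fun i ↦ ?_)
  have h1 := hμ (e i)
  rw [hB, he, real_inner_comm] at h1
  have h2 : (l i - μ) * inner ℝ (e i) v = 0 := by
    rw [real_inner_comm]; linarith
  rw [inner_zero_right]
  simpa using (mul_eq_zero.1 h2).resolve_left (sub_ne_zero.2 (h i))

open Polynomial in
/-- The product of `X - ν` over the eigenvalues annihilates a diagonalizable form. -/
lemma aeval_formEndo_eq_zero {ι : Type*} [Fintype ι] {B : V →L[ℝ] V →L[ℝ] ℝ}
    {e : OrthonormalBasis ι ℝ V} {l : ι → ℝ} (he : ∀ i w, B (e i) w = l i * inner ℝ (e i) w)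
    {s : Finset ℝ} (hs : ∀ i, l i ∈ s) : aeval (formEndo B) (∏ ν ∈ s, (X - C ν)) = 0 := by
  refine e.toBasis.ext fun i ↦ ?_
  have h1 : (formEndo B).HasEigenvector (l i) (e i) :=
    ⟨Module.End.mem_eigenspace_iff.2 ((formEndo_eq_smul_iff _ _ _).2 (he i)),
      e.orthonormal.ne_zero i⟩
  rw [OrthonormalBasis.coe_toBasis, Module.End.aeval_apply_of_hasEigenvector h1, eval_prod,
    Finset.prod_eq_zero (hs i) (by simp), zero_smul, LinearMap.zero_apply]

end LinearAlgebra

/-! ### The extremal argument for symmetric arrays -/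

section SymmetricArrays

variable {ι : Type*} {l : ι → ℝ} {F : ι → ι → ι → ℝ}

/-- The two transpositions generate all permutations of the indices, so a triple either can be
sorted by `l` or has a tie that can be moved to the last two slots. -/
lemma array_eq_zero_of_sorted (h12 : ∀ a b d, F a b d = F b a d) (h23 : ∀ a b d, F a b d = F a d b)
    (h0 : ∀ a b d, l b = l d → F a b d = 0)
    (h : ∀ a b d, l a < l b → l b < l d → F a b d = 0) (a b d : ι) : F a b d = 0 := by
  rcases lt_trichotomy (l b) (l d) with hbd | hbd | hbd
  · rcases lt_trichotomy (l a) (l b) with hab | hab | hab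
    · exact h _ _ _ hab hbd
    · rw [h23, h12]
      exact h0 _ _ _ hab
    · rcases lt_trichotomy (l a) (l d) with had | had | had
      · rw [h12]
        exact h _ _ _ hab had
      · rw [h12]
        exact h0 _ _ _ had
      · rw [h12, h23]
        exact h _ _ _ hbd had
  · exact h0 _ _ _ hbd
  · rcases lt_trichotomy (l a) (l b) with hab | hab | hab
    · rcases lt_trichotomy (l a) (l d) with had | had | had
      · rw [h23]
        exact h _ _ _ had hbd
      · rw [h12]
        exact h0 _ _ _ had
      · rw [h23, h12]
        exact h _ _ _ had hab
    · rw [h23, h12]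
      exact h0 _ _ _ hab
    · rw [h23, h12, h23]
      exact h _ _ _ hbd hab

variable [Fintype ι]

/-- The sum expressing the sectional curvature of the plane of two eigenvectors of an isoparametric
tensor through the components `F` of its covariant derivative. -/
def arrayCurvature (l : ι → ℝ) (F : ι → ι → ι → ℝ) (a b : ι) : ℝ :=
  ∑ d, 2 * F a b d ^ 2 / ((l b - l d) * (l a - l d))

/-- Take `l a < l d < l b` with `F ≠ 0` and `l b - l a` maximal. In the sum for the outer pair `a,
b`, no nonzero `F a b c` has `l c` outside the interval, so no term is positive, while the term of
`d` is negative. -/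
lemma array_eq_zero_of_nonneg (h12 : ∀ a b d, F a b d = F b a d)
    (h23 : ∀ a b d, F a b d = F a d b) (h0 : ∀ a b d, l b = l d → F a b d = 0)
    (hK : ∀ a b, l a < l b → 0 ≤ arrayCurvature l F a b) (a b d : ι) : F a b d = 0 := by
  refine array_eq_zero_of_sorted h12 h23 h0 ?_ a b d
  by_contra! hne
  let S : Set (ι × ι × ι) := {t | l t.1 < l t.2.1 ∧ l t.2.1 < l t.2.2 ∧ F t.1 t.2.1 t.2.2 ≠ 0}
  obtain ⟨a₀, d₀, b₀, h1, h2, h3⟩ := hne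
  obtain ⟨⟨a, d, b⟩, ⟨had, hdb, hF⟩, hmax⟩ :=
    S.toFinite.exists_maximalFor (fun t ↦ l t.2.2 - l t.1) S ⟨(a₀, d₀, b₀), h1, h2, h3⟩
  have hmax' (t) (ht : t ∈ S) : l t.2.2 - l t.1 ≤ l b - l a := by
    by_contra! hlt
    exact absurd (hmax ht hlt.le) (not_le.2 hlt)
  refine absurd (hK a b (had.trans hdb)) (not_le.2 ?_)
  refine Finset.sum_neg' (fun c _ ↦ ?_) ⟨d, Finset.mem_univ _, ?_⟩
  · by_cases hc : F a b c = 0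
    · simp [hc]
    have h1 : l a ≤ l c := by
      by_contra! hlt
      -- An index `c` below `a` would give a wider triple.
      have := hmax' (c, a, b) ⟨hlt, had.trans hdb, by rwa [h23, h12] at hc⟩
      simp only at this
      linarith
    have h2 : l c ≤ l b := by
      by_contra! hlt
      have := hmax' (a, b, c) ⟨had.trans hdb, hlt, hc⟩
      simp only at this
      linarith
    exact div_nonpos_of_nonneg_of_nonpos (by positivity)
      (mul_nonpos_of_nonneg_of_nonpos (by linarith) (by linarith))
  · have hF' : F a b d ≠ 0 := by rwa [h23] at hF
    exact div_neg_of_pos_of_neg (by positivity)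
      (mul_neg_of_pos_of_neg (by linarith) (by linarith))

/-- Take `l a < l d < l b` with `F ≠ 0` and the lower gap `l d - l a` minimal. In the sum for the
pair `a, d`, no nonzero `F a d c` has `l c` strictly inside the gap, so no term is negative, while
the term of `b` is positive. -/
lemma array_eq_zero_of_nonpos (h12 : ∀ a b d, F a b d = F b a d)
    (h23 : ∀ a b d, F a b d = F a d b) (h0 : ∀ a b d, l b = l d → F a b d = 0)
    (hK : ∀ a b, l a < l b → arrayCurvature l F a b ≤ 0) (a b d : ι) : F a b d = 0 := by
  refine array_eq_zero_of_sorted h12 h23 h0 ?_ a b d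
  by_contra! hne
  let S : Set (ι × ι × ι) := {t | l t.1 < l t.2.1 ∧ l t.2.1 < l t.2.2 ∧ F t.1 t.2.1 t.2.2 ≠ 0}
  obtain ⟨a₀, d₀, b₀, h1, h2, h3⟩ := hne
  obtain ⟨⟨a, d, b⟩, ⟨had, hdb, hF⟩, hmin⟩ :=
    S.toFinite.exists_minimalFor (fun t ↦ l t.2.1 - l t.1) S ⟨(a₀, d₀, b₀), h1, h2, h3⟩
  have hmin' (t) (ht : t ∈ S) : l d - l a ≤ l t.2.1 - l t.1 := by
    by_contra! hlt
    exact absurd (hmin ht hlt.le) (not_le.2 hlt)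
  refine absurd (hK a d had) (not_le.2 ?_)
  refine Finset.sum_pos' (fun c _ ↦ ?_) ⟨b, Finset.mem_univ _, ?_⟩
  · by_cases hc : F a d c = 0
    · simp [hc]
    have h1 : 0 ≤ (l d - l c) * (l a - l c) := by
      by_contra! hlt
      have h2 : l a < l c := by nlinarith
      have h3 : l c < l d := by nlinarith
      have := hmin' (a, c, d) ⟨h2, h3, by rwa [h23] at hc⟩
      simp only at this
      linarith
    exact div_nonneg (by positivity) h1
  · exact div_pos (by positivity) (mul_pos_of_neg_of_neg (by linarith) (by linarith))

end SymmetricArrays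

/-! ### Tensoriality and symmetry of the covariant derivative of a Codazzi tensor -/

section CovariantDerivative

variable {E : Type*} [NormedAddCommGroup E] [NormedSpace ℝ E] [FiniteDimensional ℝ E]
  {H : Type*} [TopologicalSpace H] {I : ModelWithCorners ℝ E H}
  {M : Type*} [TopologicalSpace M] [ChartedSpace H M] [IsManifold I ∞ M]
  [RiemannianBundle (fun x : M ↦ TangentSpace I x)]
  [IsContMDiffRiemannianBundle I ∞ E (fun x : M ↦ TangentSpace I x)]
  {T : Π x : M, TangentSpace I x →L[ℝ] TangentSpace I x →L[ℝ] ℝ}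

lemma IsCodazzi.contMDiffAt_apply (hT : IsCodazzi T) {k : WithTop ℕ∞} (hk : k ≤ ∞) {x : M}
    {X Y : Π x : M, TangentSpace I x} (hX : CMDiffAt k (T% X) x) (hY : CMDiffAt k (T% Y) x) :
    CMDiffAt k (fun y ↦ T y (X y) (Y y)) x := by
  have h : ContMDiffAt I (I.prod 𝓘(ℝ)) k
      (fun y ↦ TotalSpace.mk' ℝ (E := Bundle.Trivial M ℝ) y (T y (X y) (Y y))) x := by
    apply ContMDiffAt.clm_bundle_apply₂ (F₁ := E) (F₂ := E)
    · exact (hT.contMDiff x).of_le hk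
    · exact hX
    · exact hY
  simp only [contMDiffAt_totalSpace] at h
  exact h.2

lemma IsCodazzi.mdiffAt_apply (hT : IsCodazzi T) {x : M}
    {X Y : Π x : M, TangentSpace I x} (hX : MDiffAt (T% X) x) (hY : MDiffAt (T% Y) x) :
    MDiffAt (fun y ↦ T y (X y) (Y y)) x := by
  have h : MDifferentiableAt I (I.prod 𝓘(ℝ))
      (fun y ↦ TotalSpace.mk' ℝ (E := Bundle.Trivial M ℝ) y (T y (X y) (Y y))) x := by
    apply MDifferentiableAt.clm_bundle_apply₂ (F₁ := E) (F₂ := E)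
    · exact (hT.contMDiff x).mdifferentiableAt (by simp)
    · exact hX
    · exact hY
  simp only [mdifferentiableAt_totalSpace] at h
  exact h.2

lemma IsCodazzi.covDerivTensor_comm (hT : IsCodazzi T) (X Y Z : Π x : M, TangentSpace I x)
    (x : M) : covDerivTensor T X Y Z x = covDerivTensor T X Z Y x := by
  have h : (fun y ↦ T y (Y y) (Z y)) = fun y ↦ T y (Z y) (Y y) :=
    funext fun y ↦ hT.symm y _ _
  rw [covDerivTensor, covDerivTensor, h, hT.symm x (Y x), hT.symm x _ (Z x)]
  ring

/-- The term with the derivative of `f` from the product rule for `T(Y, f Z)` cancels the one from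
the Leibniz rule for `∇(f Z)`. -/
lemma IsCodazzi.tensorialAt_covDerivTensor (hT : IsCodazzi T) {x : M}
    {X Y : Π x : M, TangentSpace I x} (hY : MDiffAt (T% Y) x) :
    TensorialAt I E (fun Z : Π x : M, TangentSpace I x ↦ covDerivTensor T X Y Z x) x where
  smul {f Z} hf hZ := by
    have h1 := mvfderiv_fun_mul hf (hT.mdiffAt_apply hY hZ)
    have h2 := (leviCivita I M).isCovariantDerivativeOn.leibniz hZ hf
    simp only [covDerivTensor, Pi.smul_apply', h1, h2, map_smul, smul_eq_mul, map_add,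
      add_apply, smul_apply, ContinuousLinearMap.smulRight_apply]
    ring
  add {Z Z'} hZ hZ' := by
    have h1 := mvfderiv_fun_add (hT.mdiffAt_apply hY hZ) (hT.mdiffAt_apply hY hZ')
    have h2 := (leviCivita I M).isCovariantDerivativeOn.add hZ hZ'
    simp only [covDerivTensor, Pi.add_apply, h1, h2, map_add, add_apply]
    ring

lemma IsCodazzi.covDerivTensor_congr (hT : IsCodazzi T) {x : M}
    {X X' Y Y' Z Z' : Π x : M, TangentSpace I x} (hY : MDiffAt (T% Y) x)
    (hY' : MDiffAt (T% Y') x) (hZ : MDiffAt (T% Z) x) (hZ' : MDiffAt (T% Z') x)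
    (eX : X x = X' x) (eY : Y x = Y' x) (eZ : Z x = Z' x) :
    covDerivTensor T X Y Z x = covDerivTensor T X' Y' Z' x := by
  trans covDerivTensor T X' Y Z x
  · simp only [covDerivTensor, eX]
  trans covDerivTensor T X' Y Z' x
  · exact (hT.tensorialAt_covDerivTensor hY).pointwise hZ hZ' eZ
  rw [hT.covDerivTensor_comm X' Y, hT.covDerivTensor_comm X' Y']
  exact (hT.tensorialAt_covDerivTensor hZ').pointwise hY hY' eY

/-- The Codazzi equation for fields that are merely differentiable at the point. -/
lemma IsCodazzi.covDerivTensor_swap (hT : IsCodazzi T) {x : M}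
    {X Y Z : Π x : M, TangentSpace I x} (hX : MDiffAt (T% X) x) (hY : MDiffAt (T% Y) x)
    (hZ : MDiffAt (T% Z) x) : covDerivTensor T X Y Z x = covDerivTensor T Y X Z x := by
  have hd (v : TangentSpace I x) : MDiffAt (T% (FiberBundle.extend E v)) x :=
    FiberBundle.mdifferentiableAt_extend ..
  have hs (v : TangentSpace I x) : CMDiffAt ∞ (T% (FiberBundle.extend E v)) x :=
    FiberBundle.contMDiffAt_extend ..
  rw [hT.covDerivTensor_congr (X' := FiberBundle.extend E (X x)) hY (hd (Y x)) hZ (hd (Z x))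
    (by simp) (by simp) (by simp), hT.codazzi x _ _ _ (hs _) (hs _) (hs _)]
  exact hT.covDerivTensor_congr (hd _) hX (hd _) hZ (by simp) (by simp) (by simp)

/-- A Codazzi tensor whose covariant derivative vanishes on fields restricting to a basis at each
point is parallel. -/
lemma IsCodazzi.covDerivTensor_eq_zero_of_basis (hT : IsCodazzi T) {x : M} {ι : Type*}
    (b : Module.Basis ι ℝ (TangentSpace I x)) {e : ι → Π x : M, TangentSpace I x}
    (he : ∀ i, MDiffAt (T% (e i)) x) (heb : ∀ i, e i x = b i)
    (h : ∀ i j k, covDerivTensor T (e i) (e j) (e k) x = 0)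
    {X Y Z : Π x : M, TangentSpace I x} (hX : MDiffAt (T% X) x) (hY : MDiffAt (T% Y) x)
    (hZ : MDiffAt (T% Z) x) : covDerivTensor T X Y Z x = 0 := by
  have key {U V : Π x : M, TangentSpace I x} (hV : MDiffAt (T% V) x)
      (h : ∀ i, covDerivTensor T U V (e i) x = 0) {W : Π x : M, TangentSpace I x}
      (hW : MDiffAt (T% W) x) : covDerivTensor T U V W x = 0 := by
    have ht := hT.tensorialAt_covDerivTensor (X := U) hV
    have h0 : (TensorialAt.mkHom _ x ht : TangentSpace I x →ₗ[ℝ] ℝ) = 0 :=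
      b.ext fun i ↦ by
        rw [← heb, ContinuousLinearMap.coe_coe, TensorialAt.mkHom_apply ht (he i), h]
        rfl
    rw [← TensorialAt.mkHom_apply ht hW, ← ContinuousLinearMap.coe_coe, h0, LinearMap.zero_apply]
  -- The basis fields are replaced by arbitrary ones a slot at a time, the symmetries moving each
  -- slot to the last place, where `key` applies.
  have h1 (i j) : covDerivTensor T (e i) (e j) Z x = 0 := key (he j) (h i j) hZ
  have h2 (i) : covDerivTensor T (e i) Z Y x = 0 :=
    key hZ (fun j ↦ by rw [hT.covDerivTensor_comm]; exact h1 i j) hY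
  rw [hT.covDerivTensor_swap hX hY hZ, hT.covDerivTensor_comm]
  refine key hZ (fun i ↦ ?_) hX
  rw [hT.covDerivTensor_comm, hT.covDerivTensor_swap hY (he i) hZ, hT.covDerivTensor_comm]
  exact h2 i

end CovariantDerivative

/-! ### Smooth fields of eigenvectors -/

section Eigenfields

variable {E : Type*} [NormedAddCommGroup E] [NormedSpace ℝ E] [FiniteDimensional ℝ E]
  {H : Type*} [TopologicalSpace H] {I : ModelWithCorners ℝ E H}
  {M : Type*} [TopologicalSpace M] [ChartedSpace H M] [IsManifold I ∞ M]
  [RiemannianBundle (fun x : M ↦ TangentSpace I x)]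
  [IsContMDiffRiemannianBundle I ∞ E (fun x : M ↦ TangentSpace I x)]
  {T : Π x : M, TangentSpace I x →L[ℝ] TangentSpace I x →L[ℝ] ℝ}

instance finiteDimensional_tangentSpace (x : M) : FiniteDimensional ℝ (TangentSpace I x) :=
  inferInstanceAs (FiniteDimensional ℝ E)

/-- A vector field all of whose values are eigenvectors (or zero) with eigenvalue `μ`. -/
def IsEigenfield (T : Π x : M, TangentSpace I x →L[ℝ] TangentSpace I x →L[ℝ] ℝ) (μ : ℝ)
    (V : Π x : M, TangentSpace I x) : Prop :=
  ∀ (y : M) (w : TangentSpace I y), T y (V y) w = μ * inner ℝ (V y) w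

lemma IsCodazzi.contMDiffAt_formEndo (hT : IsCodazzi T) {k : WithTop ℕ∞} (hk : k ≤ ∞) {x : M}
    {X : Π x : M, TangentSpace I x} (hX : CMDiffAt k (T% X) x) :
    CMDiffAt k (T% (fun y ↦ formEndo (T y) (X y))) x := by
  refine contMDiffAt_of_inner hk fun Z hZ ↦ ?_
  simp only [inner_formEndo]
  exact hT.contMDiffAt_apply hk hX (hZ.of_le hk)

open Polynomial in
-- The field is quantified after the polynomial because the induction on the degree replaces `X` by
-- its image under `formEndo`.
lemma IsCodazzi.contMDiffAt_aeval_formEndo (hT : IsCodazzi T) {k : WithTop ℕ∞} (hk : k ≤ ∞)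
    {x : M} (p : ℝ[X]) :
    ∀ {X : Π x : M, TangentSpace I x}, CMDiffAt k (T% X) x →
      CMDiffAt k (T% (fun y ↦ aeval (formEndo (T y)) p (X y))) x := by
  induction p using Polynomial.induction_on' with
  | add p q hp hq =>
    intro X hX
    simp only [map_add, LinearMap.add_apply]
    exact (hp hX).add_section (hq hX)
  | monomial n a =>
    induction n with
    | zero =>
      intro X hX
      simp only [monomial_zero_left, aeval_C, Module.algebraMap_end_apply]
      exact contMDiffAt_const.smul_section hX
    | succ n ih =>
      intro X hX
      simp only [← monomial_mul_X, map_mul, aeval_X, Module.End.mul_apply]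
      exact ih (hT.contMDiffAt_formEndo hk hX)

/-- The eigenvalues of an isoparametric tensor at all points lie in one finite set. -/
lemma IsIsoparametric.exists_finset_eigenvalues (hT : IsIsoparametric T) (x : M) :
    ∃ s : Finset ℝ, ∀ (y : M) (u : TangentSpace I y) (ν : ℝ), u ≠ 0 →
      (∀ w, T y u w = ν * inner ℝ u w) → ν ∈ s := by
  classical
  obtain ⟨e, l, he⟩ := exists_orthonormalBasis_eigenvectors (T x) (hT.symm x)
  refine ⟨Finset.univ.image l, fun y u ν hu hν ↦ ?_⟩
  obtain ⟨u', hu', hν'⟩ := (hT.eigenvalues_const y x ν).1 ⟨u, hu, hν⟩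
  obtain ⟨i, hi⟩ := exists_eq_of_eigenvector (hT.symm x) he hu' hν'
  exact Finset.mem_image.2 ⟨i, Finset.mem_univ _, hi⟩

open Polynomial in
/-- Every eigenvector of an isoparametric tensor extends to a smooth field of eigenvectors. -/
lemma IsIsoparametric.exists_eigenfield (hT : IsIsoparametric T) {x : M} {v : TangentSpace I x}
    (hv : v ≠ 0) {μ : ℝ} (hμ : ∀ w, T x v w = μ * inner ℝ v w) :
    ∃ V : Π x : M, TangentSpace I x, V x = v ∧ CMDiffAt ∞ (T% V) x ∧ IsEigenfield T μ V := by
  classical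
  obtain ⟨s, hs⟩ := hT.exists_finset_eigenvalues x
  have hann (y : M) : aeval (formEndo (T y)) (∏ ν ∈ s, (X - C ν)) = 0 := by
    obtain ⟨e, l, he⟩ := exists_orthonormalBasis_eigenvectors (T y) (hT.symm y)
    exact aeval_formEndo_eq_zero he fun i ↦ hs y (e i) (l i) (e.orthonormal.ne_zero i) (he i)
  obtain ⟨p, hp, hpq⟩ : ∃ p : ℝ[X], p.eval μ = 1 ∧
      ∀ y, aeval (formEndo (T y)) ((X - C μ) * p) = 0 := by
    -- Up to scaling this is the Lagrange polynomial of `μ`: as `(X - μ) p` annihilates the form at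
    -- every point, `p` maps every vector into the `μ`-eigenspace. Dividing by `p(μ)` makes it fix
    -- `v`.
    let p : ℝ[X] := ∏ ν ∈ s.erase μ, (X - C ν)
    have hp : p.eval μ ≠ 0 := by
      rw [eval_prod]
      refine Finset.prod_ne_zero_iff.2 fun ν hν ↦ ?_
      simpa [sub_eq_zero] using (Finset.ne_of_mem_erase hν).symm
    have hpq : (X - C μ) * p = ∏ ν ∈ s, (X - C ν) :=
      Finset.mul_prod_erase s (fun ν ↦ X - C ν) (hs x v μ hv hμ)
    refine ⟨C (p.eval μ)⁻¹ * p, ?_, fun y ↦ ?_⟩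
    · rw [eval_mul, eval_C, inv_mul_cancel₀ hp]
    · rw [mul_left_comm, hpq, map_mul, hann, mul_zero]
  refine ⟨fun y ↦ aeval (formEndo (T y)) p (FiberBundle.extend E v y), ?_,
    hT.contMDiffAt_aeval_formEndo le_rfl _ (FiberBundle.contMDiffAt_extend ..), fun y ↦ ?_⟩
  · have hvec : (formEndo (T x)).HasEigenvector μ v :=
      ⟨Module.End.mem_eigenspace_iff.2 ((formEndo_eq_smul_iff _ _ _).2 hμ), hv⟩
    simp only [FiberBundle.extend_apply_self]
    rw [Module.End.aeval_apply_of_hasEigenvector hvec, hp, one_smul]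
  · refine (formEndo_eq_smul_iff _ _ _).1 (sub_eq_zero.1 ?_)
    have h2 := LinearMap.congr_fun (hpq y) (FiberBundle.extend E v y)
    rw [map_mul, map_sub, aeval_X, aeval_C, Module.End.mul_apply, LinearMap.sub_apply,
      Module.algebraMap_end_apply] at h2
    exact h2

lemma leviCivita_metric {x : M} {Y Z : Π x : M, TangentSpace I x} (v : TangentSpace I x)
    (hY : MDiffAt (T% Y) x) (hZ : MDiffAt (T% Z) x) :
    d% (fun y ↦ inner ℝ (Y y) (Z y)) x v =
      inner ℝ (leviCivita I M Y x v) (Z x) + inner ℝ (Y x) (leviCivita I M Z x v) := by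
  have h := (leviCivita_isMetricCompatible (I := I) (M := M)).mvfderiv_inner_eq
    (FiberBundle.extend E v) hY hZ
  simpa using h

lemma leviCivita_metric_of_eventually_eq_zero {x : M} {Y Z : Π x : M, TangentSpace I x}
    (v : TangentSpace I x) (hY : MDiffAt (T% Y) x) (hZ : MDiffAt (T% Z) x)
    (h : ∀ᶠ y in nhds x, inner ℝ (Y y) (Z y) = 0) :
    inner ℝ (leviCivita I M Y x v) (Z x) = - inner ℝ (Y x) (leviCivita I M Z x v) := by
  have h1 : d% (fun y ↦ inner ℝ (Y y) (Z y)) x v = 0 := by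
    have h2 : (fun y ↦ inner ℝ (Y y) (Z y)) =ᶠ[nhds x] fun _ ↦ (0 : ℝ) := h
    change mfderiv% (fun y ↦ inner ℝ (Y y) (Z y)) x v = (0 : ℝ)
    rw [h2.mfderiv_eq, mfderiv_const]
    rfl
  linarith [leviCivita_metric v hY hZ]

/-- The constant `μ` comes out of the derivative of `T(Y, Z) = μ ⟨Y, Z⟩`; metric compatibility then
cancels the terms with `∇_X Z`. -/
lemma IsEigenfield.covDerivTensor_eq (hT : IsCodazzi T) {μ ν : ℝ}
    {Y Z : Π x : M, TangentSpace I x} (hμ : IsEigenfield T μ Y) (hν : IsEigenfield T ν Z) {x : M}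
    (X : Π x : M, TangentSpace I x) (hY : MDiffAt (T% Y) x) (hZ : MDiffAt (T% Z) x) :
    covDerivTensor T X Y Z x = (μ - ν) * inner ℝ (leviCivita I M Y x (X x)) (Z x) := by
  have h1 : (fun y ↦ T y (Y y) (Z y)) = fun y ↦ μ * inner ℝ (Y y) (Z y) :=
    funext fun y ↦ hμ y _
  have h2 : d% (fun y ↦ μ * inner ℝ (Y y) (Z y)) x (X x) =
      μ * d% (fun y ↦ inner ℝ (Y y) (Z y)) x (X x) := by
    rw [mvfderiv_fun_mul mdifferentiableAt_const (mdiffAt_inner hY hZ), mvfderiv_const]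
    simp
  rw [covDerivTensor, h1, h2, leviCivita_metric _ hY hZ, hT.symm x _ (Z x), hν, hμ,
    real_inner_comm (Z x)]
  ring

lemma IsEigenfield.inner_eq_zero (hT : IsCodazzi T) {μ ν : ℝ} (hne : μ ≠ ν)
    {Y Z : Π x : M, TangentSpace I x} (hμ : IsEigenfield T μ Y) (hν : IsEigenfield T ν Z) (x : M) :
    inner ℝ (Y x) (Z x) = 0 := by
  have h1 := hμ x (Z x)
  rw [hT.symm, hν, real_inner_comm] at h1
  have h2 : (μ - ν) * inner ℝ (Y x) (Z x) = 0 := by linarith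
  exact (mul_eq_zero.1 h2).resolve_left (sub_ne_zero.2 hne)

/-- The eigendistributions are autoparallel. -/
lemma IsEigenfield.inner_leviCivita_self (hT : IsCodazzi T) {μ ν : ℝ} (hne : μ ≠ ν)
    {Y Z : Π x : M, TangentSpace I x} (hμ : IsEigenfield T μ Y) (hν : IsEigenfield T ν Z) {x : M}
    (hY : MDiffAt (T% Y) x) (hZ : MDiffAt (T% Z) x) :
    inner ℝ (leviCivita I M Y x (Y x)) (Z x) = 0 := by
  have h1 := hμ.covDerivTensor_eq hT hν Y hY hZ
  have h2 := hμ.covDerivTensor_eq hT hμ Z hY hY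
  -- By symmetry `(∇_Y T)(Y, Z) = (∇_Z T)(Y, Y)`, where both eigenvalues are `μ`.
  rw [hT.covDerivTensor_comm, hT.covDerivTensor_swap hY hZ hY, h2, sub_self, zero_mul] at h1
  exact (mul_eq_zero.1 h1.symm).resolve_left (sub_ne_zero.2 hne)

/-! ### Curvature of planes spanned by eigenvectors -/

lemma mlieBracket_eq_leviCivita_sub {x : M} {X Y : Π x : M, TangentSpace I x}
    (hX : MDiffAt (T% X) x) (hY : MDiffAt (T% Y) x) :
    mlieBracket I X Y x = leviCivita I M Y x (X x) - leviCivita I M X x (Y x) := by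
  have : CompleteSpace E := FiniteDimensional.complete ℝ E
  exact ((CovariantDerivative.torsion_eq_zero_iff _).1 leviCivita_torsion hX hY).symm

lemma mdiffAt_leviCivita {x : M} {X Y : Π x : M, TangentSpace I x}
    (hX : CMDiffAt ∞ (T% X) x) (hY : CMDiffAt ∞ (T% Y) x) :
    MDiffAt (T% (fun y ↦ leviCivita I M Y y (X y))) x :=
  (contMDiffAt_leviCivita (m := 1) (hX.of_le (by exact_mod_cast le_top))
    (hY.of_le (by exact_mod_cast le_top))).mdifferentiableAt one_ne_zero

/-- The curvature of the plane of two eigenvectors with different eigenvalues, in terms of first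
derivatives of fields of eigenvectors. -/
lemma IsEigenfield.inner_curvature (hT : IsCodazzi T) {μ ν : ℝ} (hne : μ ≠ ν)
    {X Y : Π x : M, TangentSpace I x} (hμ : IsEigenfield T μ X) (hν : IsEigenfield T ν Y) {x : M}
    (hX : CMDiffAt ∞ (T% X) x) (hY : CMDiffAt ∞ (T% Y) x) :
    inner ℝ (curvature X Y Y x) (X x) =
      - inner ℝ (leviCivita I M Y x (Y x)) (leviCivita I M X x (X x))
      + inner ℝ (leviCivita I M Y x (X x)) (leviCivita I M X x (Y x))
      - inner ℝ (leviCivita I M Y x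
          (leviCivita I M Y x (X x) - leviCivita I M X x (Y x))) (X x) := by
  have h1 : (1 : WithTop ℕ∞) ≤ ∞ := by exact_mod_cast le_top
  have hXe := eventually_mdifferentiableAt (hX.of_le h1)
  have hYe := eventually_mdifferentiableAt (hY.of_le h1)
  have hX1 := hXe.self_of_nhds
  have hY1 := hYe.self_of_nhds
  -- Both `⟨∇_Y Y, X⟩` and `⟨∇_X Y, X⟩ = -⟨Y, ∇_X X⟩` vanish near `x`, so differentiating them
  -- trades second derivatives for products of first ones.
  have e1 := leviCivita_metric_of_eventually_eq_zero (X x) (mdiffAt_leviCivita hY hY) hX1 (by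
    filter_upwards [hXe, hYe] with y hXy hYy
    exact hν.inner_leviCivita_self hT hne.symm hμ hYy hXy)
  have e2 := leviCivita_metric_of_eventually_eq_zero (Y x) (mdiffAt_leviCivita hX hY) hX1 (by
    filter_upwards [hXe, hYe] with y hXy hYy
    rw [leviCivita_metric_of_eventually_eq_zero _ hYy hXy
      (Filter.Eventually.of_forall (hν.inner_eq_zero hT hne.symm hμ)), real_inner_comm,
      hμ.inner_leviCivita_self hT hne hν hXy hYy, neg_zero])
  rw [curvature, mlieBracket_eq_leviCivita_sub hX1 hY1, inner_sub_left, inner_sub_left, e1, e2]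
  ring

/-- The curvature of the plane of two eigenvectors with different eigenvalues, in terms of the
covariant derivative of the tensor. -/
lemma IsEigenfield.inner_curvature_eq_arrayCurvature (hT : IsCodazzi T) {x : M} {ι : Type*}
    [Fintype ι] (b : OrthonormalBasis ι ℝ (TangentSpace I x)) {l : ι → ℝ}
    {e : ι → Π x : M, TangentSpace I x} (he : ∀ i, CMDiffAt ∞ (T% (e i)) x)
    (heb : ∀ i, e i x = b i) (hl : ∀ i, IsEigenfield T (l i) (e i)) {i j : ι} (hij : l i ≠ l j) :
    inner ℝ (curvature (e i) (e j) (e j) x) (e i x) =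
      arrayCurvature l (fun i j k ↦ covDerivTensor T (e i) (e j) (e k) x) i j := by
  have hd (i) : MDiffAt (T% (e i)) x := (he i).mdifferentiableAt (by simp)
  have parseval (v w : TangentSpace I x) :
      inner ℝ v w = ∑ k, inner ℝ v (e k x) * inner ℝ w (e k x) := by
    rw [← b.sum_inner_mul_inner]
    exact Finset.sum_congr rfl fun k _ ↦ by rw [heb, real_inner_comm w]
  rw [(hl i).inner_curvature hT hij (hl j) (he i) (he j)]
  set P := leviCivita I M (e j) x (e i x)
  set Q := leviCivita I M (e i) x (e j x)
  have expand : inner ℝ (leviCivita I M (e j) x (P - Q)) (e i x) =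
      ∑ k, inner ℝ (P - Q) (e k x) * inner ℝ (leviCivita I M (e j) x (e k x)) (e i x) := by
    conv_lhs => rw [← b.sum_repr' (P - Q)]
    simp only [map_sum, map_smul, sum_inner, real_inner_smul_left]
    exact Finset.sum_congr rfl fun k _ ↦ by rw [heb k, real_inner_comm]
  rw [expand, parseval (leviCivita I M (e j) x (e j x)), parseval P, ← Finset.sum_neg_distrib,
    ← Finset.sum_add_distrib, ← Finset.sum_sub_distrib, arrayCurvature]
  refine Finset.sum_congr rfl fun k _ ↦ ?_
  set f := covDerivTensor T (e i) (e j) (e k) x with hf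
  have hp : f = (l j - l k) * inner ℝ P (e k x) :=
    (hl j).covDerivTensor_eq hT (hl k) (e i) (hd j) (hd k)
  have hq : f = (l i - l k) * inner ℝ Q (e k x) := by
    rw [hf, hT.covDerivTensor_swap (hd i) (hd j) (hd k)]
    exact (hl i).covDerivTensor_eq hT (hl k) (e j) (hd i) (hd k)
  -- Total symmetry rewrites `f` as `(∇_{e k} T)(e j, e i)`.
  have hr : f = (l j - l i) * inner ℝ (leviCivita I M (e j) x (e k x)) (e i x) := by
    rw [hf, hT.covDerivTensor_comm, hT.covDerivTensor_swap (hd i) (hd k) (hd j),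
      hT.covDerivTensor_comm]
    exact (hl j).covDerivTensor_eq hT (hl i) (e k) (hd j) (hd i)
  -- Since `l i ≠ l j`, the eigenvalue `l k` differs from one of them, and the corresponding factor
  -- vanishes.
  have hz : inner ℝ (leviCivita I M (e j) x (e j x)) (e k x) *
      inner ℝ (leviCivita I M (e i) x (e i x)) (e k x) = 0 := by
    by_cases hk : l k = l j
    · rw [(hl i).inner_leviCivita_self hT (by rwa [hk]) (hl k) (hd i) (hd k), mul_zero]
    · rw [(hl j).inner_leviCivita_self hT (Ne.symm hk) (hl k) (hd j) (hd k), zero_mul]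
  rw [hz, inner_sub_left]
  generalize inner ℝ P (e k x) = p at *
  generalize inner ℝ Q (e k x) = q at *
  generalize inner ℝ (leviCivita I M (e j) x (e k x)) (e i x) = r at *
  clear_value f
  have hji : l j - l i ≠ 0 := sub_ne_zero.2 hij.symm
  -- If `l k` equals `l j` or `l i`, then `f = 0` and the summand of `arrayCurvature` is zero by the
  -- convention for division by zero; the left side vanishes too, although `p` or `q` may not.
  by_cases hkj : l j - l k = 0
  · have f0 : f = 0 := by rw [hp, hkj, zero_mul]
    have r0 : r = 0 := (mul_eq_zero.1 (hr.symm.trans f0)).resolve_left hji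
    have q0 : q = 0 := (mul_eq_zero.1 (hq.symm.trans f0)).resolve_left fun h ↦ hji (by linarith)
    simp [f0, r0, q0]
  by_cases hki : l i - l k = 0
  · have f0 : f = 0 := by rw [hq, hki, zero_mul]
    have r0 : r = 0 := (mul_eq_zero.1 (hr.symm.trans f0)).resolve_left hji
    have p0 : p = 0 := (mul_eq_zero.1 (hp.symm.trans f0)).resolve_left hkj
    simp [f0, r0, p0]
  have p1 : p = f / (l j - l k) := by rw [hp]; field_simp
  have q1 : q = f / (l i - l k) := by rw [hq]; field_simp
  have r1 : r = f / (l j - l i) := by rw [hr]; field_simp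
  rw [p1, q1, r1]
  field_simp
  ring

/-- On a manifold whose sectional curvature has a sign, isoparametric tensors are parallel. -/
theorem IsIsoparametric.isParallel (hT : IsIsoparametric T)
    (hsec : HasNonnegSectionalCurvature I M ∨ HasNonposSectionalCurvature I M) :
    IsParallel T := by
  intro x X Y Z hX hY hZ
  obtain ⟨b, l, hb⟩ := exists_orthonormalBasis_eigenvectors (T x) (hT.symm x)
  -- These fields are eigenfields everywhere, but orthonormality is known only at `x`, which is all
  -- the curvature formula requires.
  choose e heb he hl using fun i ↦ hT.exists_eigenfield (b.orthonormal.ne_zero i) (hb i)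
  have hd (i) : MDiffAt (T% (e i)) x := (he i).mdifferentiableAt (by simp)
  have hC := hT.toIsCodazzi
  refine hC.covDerivTensor_eq_zero_of_basis b.toBasis hd (by simpa using heb) ?_
    (hX.mdifferentiableAt (by simp)) (hY.mdifferentiableAt (by simp))
    (hZ.mdifferentiableAt (by simp))
  have h12 (i j k) : covDerivTensor T (e i) (e j) (e k) x = covDerivTensor T (e j) (e i) (e k) x :=
    hC.covDerivTensor_swap (hd i) (hd j) (hd k)
  have h23 (i j k) : covDerivTensor T (e i) (e j) (e k) x = covDerivTensor T (e i) (e k) (e j) x :=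
    hC.covDerivTensor_comm _ _ _ _
  have h0 (i j k) (h : l j = l k) : covDerivTensor T (e i) (e j) (e k) x = 0 := by
    rw [(hl j).covDerivTensor_eq hC (hl k) _ (hd j) (hd k), h, sub_self, zero_mul]
  have hli (i j) (hij : l i < l j) : LinearIndependent ℝ ![e i x, e j x] := by
    have hne : i ≠ j := fun h ↦ hij.ne (congrArg l h)
    have h := b.orthonormal.linearIndependent.comp ![i, j] (by
      intro a c; fin_cases a <;> fin_cases c <;> simp [hne, hne.symm])
    have h3 : ⇑b ∘ ![i, j] = ![e i x, e j x] := by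
      ext a
      fin_cases a <;> simp [heb]
    rw [h3] at h
    exact h
  have hK (i j) (hij : l i < l j) : sectionalCurvature (e i) (e j) x =
      arrayCurvature l (fun i j k ↦ covDerivTensor T (e i) (e j) (e k) x) i j := by
    have hne : i ≠ j := fun h ↦ hij.ne (congrArg l h)
    rw [← IsEigenfield.inner_curvature_eq_arrayCurvature hC b he heb hl hij.ne, sectionalCurvature]
    have h1 : inner ℝ (e i x) (e i x) * inner ℝ (e j x) (e j x) - inner ℝ (e i x) (e j x) ^ 2 =
        (1 : ℝ) := by
      rw [heb, heb, b.inner_eq_one, b.inner_eq_one, b.inner_eq_zero hne]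
      norm_num
    rw [h1, div_one]
  rcases hsec with h | h
  · exact array_eq_zero_of_nonneg h12 h23 h0 fun i j hij ↦ by
      rw [← hK i j hij]
      exact h x _ _ (he i) (he j) (hli i j hij)
  · exact array_eq_zero_of_nonpos h12 h23 h0 fun i j hij ↦ by
      rw [← hK i j hij]
      exact h x _ _ (he i) (he j) (hli i j hij)

end Eigenfields

end Riem

end

/-- On a Riemannian manifold with non-negative, or with non-positive, sectional curvature, every
isoparametric tensor is parallel. -/
theorem theoremA4 (n : ℕ) {M : Type*} [TopologicalSpace M]
    [ChartedSpace (EuclideanSpace ℝ (Fin n)) M] [IsManifold (𝓡 n) ∞ M]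
    [RiemannianBundle (fun x : M ↦ TangentSpace (𝓡 n) x)]
    [IsContMDiffRiemannianBundle (𝓡 n) ∞ (EuclideanSpace ℝ (Fin n))
      (fun x : M ↦ TangentSpace (𝓡 n) x)]
    (T : Π x : M, TangentSpace (𝓡 n) x →L[ℝ] TangentSpace (𝓡 n) x →L[ℝ] ℝ)
    (hT : Riem.IsIsoparametric T)
    (hsec : Riem.HasNonnegSectionalCurvature (𝓡 n) M ∨
      Riem.HasNonposSectionalCurvature (𝓡 n) M) :
    Riem.IsParallel T := by
  exact hT.isParallel hsec
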